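/- **Setting.** Let $n\in\mathbb N$, $\tau\in(0,1]$, $T>0$, and let $\gamma$ be positive and integrable on $(0,T)$. Write $\mathcal F f(\xi)=\hat f(\xi)=\int_{\mathbb R^n} f(x)e^{-2\pi i x\cdot\xi}\,dx$ for the Fourier transform (extended to $L^2(\mathbb R^n)$ by Plancherel), $\|\cdot\|$ for the $L^2(\mathbb R^n)$ norm, $|||\cdot|||$ for the operator norm on $L^2(\mathbb R^n)$, and $\|f\|_{H^p}=\|(1+|\xi|^2)^{p/2}\hat f\|$. Let $$A=\mathcal F^{-1}\psi\,\mathcal F,\qquad \psi(\xi)=\exp\Big(-|2\pi\xi|^{2\tau}\int_0^T\gamma(\lambda)\,d\lambda\Big).$$ Let $u(\cdot,t)\in L^2(\mathbb R^n)$, $t\in[0,T]$, solve $\partial_t u+\gamma(t)(-\Delta)^\tau u=0$ on $\mathbb R^n\times(0,T)$, that is, for almost every $\xi$ the function $t\mapsto\hat u(\xi,t)$ is continuous on $[0,T]$ and solves $\partial_t\hat u(\xi,t)=-\gamma(t)|2\pi\xi|^{2\tau}\hat u(\xi,t)$ in integrated form; put $g=u(\cdot,T)$ (so that $Au(\cdot,0)=g$).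 Let $\phi\in L^1(\mathbb R^n)$ be real-valued with $\int\phi=1$, $|\hat\phi(\xi)|<1$ for $\xi\neq0$, and, for some $s>0$, $|1-\hat\phi(\xi)|\sim|\xi|^s$ as $\xi\to0$ (it suffices that each side is bounded by a constant multiple of the other near $0$). For $\beta>0$ let $\phi_\beta(x)=\beta^{-n}\phi(x/\beta)$ and $C_\beta f=\phi_\beta\star f$. For $q>0$ let $f_q(t)=(-\ln t)^{-q}$, $0<t<1$. **Theorem.** Let $p>0$, $q=p/(2\tau)$, and let $C(p)>0$ be any constant. For every $\eta\in(0,1)$ there is a constant $\bar K>0$, depending only on $n,\tau,T,\gamma,\phi,s,p,C(p),\eta$, such that the following holds for all $E>0$ with $\rho:=C(p)E$ and all real $\delta,h$ with $0<h+\delta/\rho\le\eta$. Suppose that $\|u(\cdot,0)\|_{H^p}\le E$, that $g^\delta\in L^2(\mathbb R^n)$ satisfies $\|g-g^\delta\|\le\delta$, and that $A_h$ is a bounded convolution operator on $L^2(\mathbb R^n)$, i.e. $A_h=\mathcal F^{-1}\psi_h\,\mathcal F$ for a measurable function $\psi_h$, with $|||A-A_h|||\le h$ and $|||A_h|||\le1$.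 Then for $\beta=(h+\delta/\rho)^{1/(2s)}$ the functional $$v\mapsto\|A_hv-g^\delta\|^2+\|(I-C_\beta)v\|^2$$ has a unique minimizer $u_\beta^{\delta,h}$ in $L^2(\mathbb R^n)$, and $$\|u(\cdot,0)-u_\beta^{\delta,h}\|\le\bar K\,\rho\,f_q\big((h+\delta/\rho)^2\big).$$ -/

import Mathlib

open MeasureTheory Filter Topology Set Asymptotics
open scoped FourierTransform ENNReal Convolution

noncomputable section

namespace BackwardHeat

/-- The space `ℝⁿ` with its Euclidean norm. -/
abbrev Space (n : ℕ) : Type := EuclideanSpace ℝ (Fin n)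

/-- The complex Hilbert space `L²(ℝⁿ)`. Its Fourier transform `𝓕` is Mathlib's unitary (Plancherel)
transform, with the convention `𝓕 f ξ = ∫ f(x) exp(-2πi x·ξ) dx`. -/
abbrev L2 (n : ℕ) : Type := Lp ℂ 2 (volume : Measure (Space n))

variable {n : ℕ}

/-- The Fourier multiplier operator `𝓕⁻¹ m 𝓕` on `L²(ℝⁿ)` of a bounded measurable symbol `m`. -/
def fourierMultiplier (m : Space n → ℂ) (hm : MemLp m ∞ (volume : Measure (Space n))) :
    L2 n →L[ℂ] L2 n :=
  ((Lp.fourierTransformₗᵢ (Space n) ℂ).symm.toContinuousLinearEquiv : L2 n →L[ℂ] L2 n) ∘L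
    ((ContinuousLinearMap.mul ℂ ℂ).holderL volume ∞ 2 2 (hm.toLp m)) ∘L
    ((Lp.fourierTransformₗᵢ (Space n) ℂ).toContinuousLinearEquiv : L2 n →L[ℂ] L2 n)

theorem fourier_fourierMultiplier (m : Space n → ℂ)
    (hm : MemLp m ∞ (volume : Measure (Space n))) (f : L2 n) :
    (𝓕 (fourierMultiplier m hm f) : L2 n) =ᵐ[volume] fun ξ => m ξ * (𝓕 f : L2 n) ξ := by
  have h : (𝓕 (fourierMultiplier m hm f) : L2 n) =
      (ContinuousLinearMap.mul ℂ ℂ).holder 2 (hm.toLp m) (𝓕 f : L2 n) := by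
    change (Lp.fourierTransformₗᵢ (Space n) ℂ) ((Lp.fourierTransformₗᵢ (Space n) ℂ).symm _) = _
    rw [LinearIsometryEquiv.apply_symm_apply]
    rfl
  rw [h]
  filter_upwards [(ContinuousLinearMap.mul ℂ ℂ).coeFn_holder (r := 2) (hm.toLp m) (𝓕 f : L2 n),
    hm.coeFn_toLp] with ξ h1 h2
  rw [h1, h2]
  rfl

/-- `ψ(ξ) = exp (-|2πξ|^{2τ} ∫₀ᵀ γ)`. -/
def heatSymbol (τ T : ℝ) (γ : ℝ → ℝ) (ξ : Space n) : ℝ :=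
  Real.exp (-((2 * Real.pi * ‖ξ‖) ^ (2 * τ) * ∫ t in (0 : ℝ)..T, γ t))

theorem memLp_heatSymbol (τ T : ℝ) (hτ : 0 < τ) (hT : 0 < T) (γ : ℝ → ℝ)
    (hγ : ∀ t ∈ Ioo 0 T, 0 < γ t) :
    MemLp (fun ξ : Space n => (heatSymbol τ T γ ξ : ℂ)) ∞ volume := by
  have hc : Continuous fun ξ : Space n => (2 * Real.pi * ‖ξ‖) ^ (2 * τ) :=
    (continuous_const.mul continuous_norm).rpow_const fun _ => Or.inr (by positivity)
  have hcont : Continuous fun ξ : Space n => (heatSymbol τ T γ ξ : ℂ) :=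
    Complex.continuous_ofReal.comp (Real.continuous_exp.comp (hc.mul continuous_const).neg)
  refine memLp_top_of_bound hcont.aestronglyMeasurable 1 (Eventually.of_forall fun ξ => ?_)
  have h0 : 0 ≤ ∫ t in (0 : ℝ)..T, γ t := by
    rw [intervalIntegral.integral_of_le hT.le, integral_Ioc_eq_integral_Ioo]
    exact setIntegral_nonneg measurableSet_Ioo fun t ht => (hγ t ht).le
  rw [Complex.norm_real, Real.norm_eq_abs, heatSymbol, Real.abs_exp]
  exact Real.exp_le_one_iff.2 (neg_nonpos.2 (by positivity))

/-- The forward operator `A = 𝓕⁻¹ ψ 𝓕` on `L²(ℝⁿ)`. -/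
def heatOperator (n : ℕ) (τ T : ℝ) (hτ : 0 < τ) (hT : 0 < T) (γ : ℝ → ℝ)
    (hγ : ∀ t ∈ Ioo 0 T, 0 < γ t) : L2 n →L[ℂ] L2 n :=
  fourierMultiplier (fun ξ => (heatSymbol τ T γ ξ : ℂ)) (memLp_heatSymbol τ T hτ hT γ hγ)

/-- `u : [0,T] → L²(ℝⁿ)` solves `∂ₜ u + γ(t) (-Δ)^τ u = 0` on `(0,T)`. On the Fourier side this is
`∂ₜ û(ξ,t) = -γ(t) |2πξ|^{2τ} û(ξ,t)` for almost every `ξ`; since `γ` is only integrable, the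
ordinary differential equation in `t` is understood in integrated form. The function `v` is a
representative of `û` that is continuous in time. -/
def IsHeatSolution (τ T : ℝ) (γ : ℝ → ℝ) (u : ℝ → L2 n) : Prop :=
  ∃ v : ℝ → Space n → ℂ,
    (∀ t ∈ Icc 0 T, v t =ᵐ[volume] (𝓕 (u t) : L2 n)) ∧
    ∀ᵐ ξ : Space n, ContinuousOn (fun t => v t ξ) (Icc 0 T) ∧
      ∀ t ∈ Icc 0 T, v t ξ =
        v 0 ξ - ∫ r in (0 : ℝ)..t, ((γ r * (2 * Real.pi * ‖ξ‖) ^ (2 * τ) : ℝ) : ℂ) * v r ξ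

/-- A bounded operator on `L²(ℝⁿ)` is a convolution operator if it is `𝓕⁻¹ m 𝓕` for a measurable
function `m`, the Fourier transform of the convolution kernel. -/
def IsConvolutionOperator (B : L2 n →L[ℂ] L2 n) : Prop :=
  ∃ m : Space n → ℂ, AEStronglyMeasurable m volume ∧
    ∀ f : L2 n, (𝓕 (B f) : L2 n) =ᵐ[volume] fun ξ => m ξ * (𝓕 f : L2 n) ξ

/-- The Sobolev norm `‖f‖_{H^p} = ‖(1 + |ξ|²)^{p/2} f̂‖_{L²}`; it is `∞` when `f ∉ H^p(ℝⁿ)`. -/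
def sobolevNorm (p : ℝ) (f : L2 n) : ℝ≥0∞ :=
  eLpNorm (fun ξ : Space n => (((1 + ‖ξ‖ ^ 2) ^ (p / 2) : ℝ) : ℂ) * (𝓕 f : L2 n) ξ) 2 volume

/-- `φ_β(x) = β⁻ⁿ φ(x/β)`. -/
def dilate (φ : Space n → ℝ) (β : ℝ) (x : Space n) : ℝ :=
  (β ^ n)⁻¹ * φ (β⁻¹ • x)

/-- The mollification `C_β f = φ_β ⋆ f`. -/
def mollify (φ : Space n → ℝ) (β : ℝ) (f : Space n → ℂ) : Space n → ℂ :=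
  dilate φ β ⋆[ContinuousLinearMap.lsmul ℝ ℝ, volume] f

theorem mollify_apply (φ : Space n → ℝ) (β : ℝ) (f : Space n → ℂ) (x : Space n) :
    mollify φ β f x = ∫ y, (dilate φ β (x - y) : ℂ) * f y := by
  rw [mollify, convolution_eq_swap]
  simp

/-- The functional `‖B u - g‖² + ‖(I - C_β) u‖²` (norms of `L²(ℝⁿ)`). -/
def mollifiedFunctional (φ : Space n → ℝ) (β : ℝ) (B : L2 n →L[ℂ] L2 n) (g u : L2 n) : ℝ≥0∞ :=
  eLpNorm (fun x => (B u - g : L2 n) x) 2 volume ^ 2 +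
    eLpNorm (fun x => u x - mollify φ β (u : Space n → ℂ) x) 2 volume ^ 2

/-- `v` minimizes `u ↦ ‖B u - g‖² + ‖(I - C_β) u‖²` over `L²(ℝⁿ)`. -/
def IsReconstruction (φ : Space n → ℝ) (β : ℝ) (B : L2 n →L[ℂ] L2 n) (g v : L2 n) : Prop :=
  ∀ u : L2 n, mollifiedFunctional φ β B g v ≤ mollifiedFunctional φ β B g u

/-- The logarithmic source function `f_q(t) = (-ln t)^{-q}`, for `0 < t < 1`. -/
def logSource (q t : ℝ) : ℝ := (-Real.log t) ^ (-q)

end BackwardHeat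

end

noncomputable section

namespace BackwardHeat

/-! Everything is diagonal in frequency. Write `b` for the symbol of `Ah`, `m ξ = 1 - φ̂(βξ)`, `ε =
h + δ/ρ`, `L = -log ε`. The functional is quadratic, and its normal equation is solved by the
multiplier `conj b / (|b|² + |m|²)` applied to the data (`isReconstruction_iff`). The error is then
`|m|² / (|b|² + |m|²)` acting on `u 0`, plus the regularized inverse acting on a residual of norm
`O(ρ ε)` (`norm_sub_regularized_le`).

Two pointwise bounds remain. All they need about `b` is `|ψ - b| ≤ ε` a.e., because the operator
norm of a multiplier dominates its symbol. The choice of `β` gives `β^s = ε^{1/2}`, so `|m|` is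
comparable to `min 1 (ε^{1/2} |ξ|^s)`. Regularized inverse (`exists_bound_regularized_inverse`):
near the origin `|b|` is bounded below, elsewhere `|m| ≳ ε^{1/2}`. Its norm is `O(ε^{-1/2})`, and
the data error `O(ρ ε^{1/2})` is bounded by any power of `1/L`. Approximation error
(`exists_bound_filter`): for `|ξ| ≥ κ L^{1/(2τ)}` the Sobolev weight already pays for `L^{-q}`;
below that radius `ψ ≥ ε^{1/4}` beats `|m| ≲ ε^{1/2} |ξ|^s`. -/

/-! ### The integrated evolution equation -/

theorem absolutelyContinuousOnInterval_exp {K : ℝ → ℝ} {a b : ℝ}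
    (hK : AbsolutelyContinuousOnInterval K a b) :
    AbsolutelyContinuousOnInterval (fun t => Real.exp (K t)) a b := by
  obtain ⟨C, hC⟩ := hK.exists_bound
  -- `K` is bounded by `C` on the interval, and `exp` is Lipschitz on the half-line below `C`.
  have hlip : ∀ x ∈ uIcc a b, ∀ y ∈ uIcc a b,
      dist (Real.exp (K x)) (Real.exp (K y)) ≤ Real.exp C * dist (K x) (K y) := by
    intro x hx y hy
    have hmem : ∀ z ∈ uIcc a b, K z ∈ Iic C := fun z hz => (le_abs_self _).trans (hC z hz)
    have h := (convex_Iic C).norm_image_sub_le_of_norm_hasDerivWithin_le (f := Real.exp)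
      (f' := Real.exp) (C := Real.exp C)
      (fun z _ => (Real.hasDerivAt_exp z).hasDerivWithinAt)
      (fun z hz => by
        rw [Real.norm_eq_abs, Real.abs_exp]; exact Real.exp_le_exp.2 hz) (hmem y hy) (hmem x hx)
    simpa [dist_eq_norm] using h
  have h0 := hK.const_mul (Real.exp C)
  refine squeeze_zero'
    (Eventually.of_forall fun E => Finset.sum_nonneg fun i _ => dist_nonneg) ?_ h0
  filter_upwards [mem_inf_of_right (mem_principal_self _)] with E hE
  refine Finset.sum_le_sum fun i hi => (hlip _ (hE.1 i hi).1 _ (hE.1 i hi).2).trans ?_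
  simp only [Real.dist_eq, ← mul_sub, abs_mul, Real.abs_exp, le_refl]

/-- Integrating factor: `exp (∫ k) * y` has zero derivative almost everywhere. As `k` is only
integrable, constancy comes from absolute continuity of the product. -/
theorem eq_exp_mul_of_eq_sub_integral {k y : ℝ → ℝ} {T : ℝ} (hT : 0 ≤ T)
    (hk : IntervalIntegrable k volume 0 T) (hy : ContinuousOn y (Icc 0 T))
    (h : ∀ t ∈ Icc 0 T, y t = y 0 - ∫ r in (0 : ℝ)..t, k r * y r) :
    y T = Real.exp (-∫ r in (0 : ℝ)..T, k r) * y 0 := by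
  have hI : uIcc 0 T = Icc 0 T := uIcc_of_le hT
  have hky : IntervalIntegrable (fun r => k r * y r) volume 0 T := hk.mul_continuousOn (hI ▸ hy)
  have hKac := hk.absolutelyContinuousOnInterval_intervalIntegral (c := 0) left_mem_uIcc
  have hYac := hky.absolutelyContinuousOnInterval_intervalIntegral (c := 0) left_mem_uIcc
  have hconst : AbsolutelyContinuousOnInterval (fun _ : ℝ => y 0) 0 T :=
    (contDiff_const.contDiffOn).absolutelyContinuousOnInterval
  have hW := (absolutelyContinuousOnInterval_exp hKac).mul (hconst.sub hYac)
  obtain ⟨C, hC⟩ := hW.const_of_ae_hasDerivAt_zero (by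
    filter_upwards [hk.ae_hasDerivAt_integral, hky.ae_hasDerivAt_integral] with t h1 h2 ht
    have d1 := (h1 ht 0 left_mem_uIcc).exp
    have d2 := (hasDerivAt_const t (y 0)).sub (h2 ht 0 left_mem_uIcc)
    convert! d1.mul d2 using 1
    have e := h t (hI ▸ ht)
    simp only [Pi.sub_apply, ← e]
    ring)
  have e0 := hC 0 left_mem_uIcc
  have eT := hC T right_mem_uIcc
  simp only [Pi.mul_apply, Pi.sub_apply, intervalIntegral.integral_same, Real.exp_zero, sub_zero,
    one_mul, ← h T (right_mem_Icc.2 hT)] at e0 eT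
  rw [e0, ← eT, ← mul_assoc, ← Real.exp_add]
  simp

theorem complex_eq_exp_mul_of_eq_sub_integral {k : ℝ → ℝ} {y : ℝ → ℂ} {T : ℝ} (hT : 0 ≤ T)
    (hk : IntervalIntegrable k volume 0 T) (hy : ContinuousOn y (Icc 0 T))
    (h : ∀ t ∈ Icc 0 T, y t = y 0 - ∫ r in (0 : ℝ)..t, (k r : ℂ) * y r) :
    y T = (Real.exp (-∫ r in (0 : ℝ)..T, k r) : ℂ) * y 0 := by
  have hI : uIcc 0 T = Icc 0 T := uIcc_of_le hT
  have hky : IntervalIntegrable (fun r => (k r : ℂ) * y r) volume 0 T :=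
    IntervalIntegrable.mul_continuousOn ⟨hk.1.ofReal, hk.2.ofReal⟩ (hI ▸ hy)
  have key : ∀ L : ℂ →L[ℝ] ℝ, L (y T) = Real.exp (-∫ r in (0 : ℝ)..T, k r) * L (y 0) := by
    intro L
    refine eq_exp_mul_of_eq_sub_integral (y := fun t => L (y t)) hT hk
      (L.continuous.comp_continuousOn hy) fun t ht => ?_
    have hsub : IntervalIntegrable (fun r => (k r : ℂ) * y r) volume 0 t :=
      hky.mono_set (by rw [hI, uIcc_of_le ht.1]; exact Icc_subset_Icc_right ht.2)
    have e := congrArg L (h t ht)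
    rw [map_sub, ← L.intervalIntegral_comp_comm hsub] at e
    rw [e]
    congr 1
    refine intervalIntegral.integral_congr fun r _ => ?_
    simp only [← Complex.real_smul, map_smul, smul_eq_mul]
  apply Complex.ext
  · rw [Complex.re_ofReal_mul]; exact key Complex.reCLM
  · rw [Complex.im_ofReal_mul]; exact key Complex.imCLM

/-- The only use of the evolution equation: for almost every frequency it is a linear ODE in time
whose solution operator at `T` is `ψ`. -/
theorem heatOperator_apply_of_isHeatSolution {n : ℕ} {τ T : ℝ} (hτ : 0 < τ) (hT : 0 < T)
    {γ : ℝ → ℝ} (hγ : ∀ t ∈ Ioo 0 T, 0 < γ t) (hγint : IntegrableOn γ (Ioo 0 T) volume)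
    {u : ℝ → L2 n} (hu : IsHeatSolution τ T γ u) :
    heatOperator n τ T hτ hT γ hγ (u 0) = u T := by
  obtain ⟨v, hv, hode⟩ := hu
  have hγi : IntervalIntegrable γ volume 0 T := by
    rw [intervalIntegrable_iff_integrableOn_Ioo_of_le hT.le]; exact hγint
  apply (Lp.fourierTransformₗᵢ (Space n) ℂ).injective
  change (𝓕 (heatOperator n τ T hτ hT γ hγ (u 0)) : L2 n) = 𝓕 (u T)
  apply Lp.ext
  filter_upwards [fourier_fourierMultiplier _ (memLp_heatSymbol τ T hτ hT γ hγ) (u 0), hode,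
    hv 0 (left_mem_Icc.2 hT.le), hv T (right_mem_Icc.2 hT.le)] with ξ h1 h2 h3 h4
  rw [heatOperator, h1, ← h4, ← h3,
    complex_eq_exp_mul_of_eq_sub_integral hT.le (hγi.mul_const _) h2.1 h2.2,
    intervalIntegral.integral_mul_const, heatSymbol, mul_comm (∫ r in (0 : ℝ)..T, γ r)]

/-! ### Convolution of `L¹` with `L²` -/

variable {n : ℕ}

theorem aestronglyMeasurable_convolution {φ : Space n → ℝ} {f : Space n → ℂ}
    (hφ : Integrable φ volume) (hf : AEStronglyMeasurable f volume) :
    AEStronglyMeasurable (φ ⋆[ContinuousLinearMap.lsmul ℝ ℝ, volume] f) volume :=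
  (hφ.aestronglyMeasurable.convolution_integrand
    (ContinuousLinearMap.lsmul ℝ ℝ) hf).integral_prod_right'

/-- The Cauchy-Schwarz inequality behind Young's inequality for `L¹ ⋆ L²`. -/
theorem ae_convolutionExistsAt_and_sq_norm_convolution_le {φ : Space n → ℝ} {f : Space n → ℂ}
    (hφ : Integrable φ volume) (hf : MemLp f 2 volume) :
    ∀ᵐ x, ConvolutionExistsAt φ f x (ContinuousLinearMap.lsmul ℝ ℝ) volume ∧
      ‖(φ ⋆[ContinuousLinearMap.lsmul ℝ ℝ, volume] f) x‖ ^ 2 ≤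
        (∫ y, ‖φ y‖) *
          ((fun y => ‖φ y‖) ⋆[ContinuousLinearMap.mul ℝ ℝ, volume] fun y => ‖f y‖ ^ 2) x := by
  have hf2 : Integrable (fun y => ‖f y‖ ^ 2) volume :=
    (memLp_two_iff_integrable_sq_norm hf.1).1 hf
  filter_upwards [hφ.norm.ae_convolution_exists (ContinuousLinearMap.mul ℝ ℝ) hf2] with x hx
  have hS : Integrable (fun y => ‖φ y‖ * ‖f (x - y)‖ ^ 2) volume := hx
  have hmeas : AEStronglyMeasurable (fun y => f (x - y)) volume :=
    hf.1.comp_quasiMeasurePreserving (quasiMeasurePreserving_sub_left_of_right_invariant volume x)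
  have hN := hφ.norm
  have hc : Integrable (fun y => ‖φ y‖ * ‖f (x - y)‖) volume := by
    -- Domination by `t ≤ 1 + t²` with `t = ‖f (x - y)‖`.
    refine (hN.add hS).mono' (hN.aestronglyMeasurable.mul hmeas.norm)
      (Eventually.of_forall fun y => ?_)
    have h1 := norm_nonneg (φ y)
    rw [Real.norm_of_nonneg (by positivity), Pi.add_apply]
    nlinarith [sq_nonneg (‖f (x - y)‖ - 1), mul_nonneg h1 (sq_nonneg (‖f (x - y)‖ - 1)),
      mul_nonneg h1 (norm_nonneg (f (x - y)))]
  have hex : ConvolutionExistsAt φ f x (ContinuousLinearMap.lsmul ℝ ℝ) volume := by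
    refine hc.mono' (hφ.aestronglyMeasurable.smul hmeas) (Eventually.of_forall fun y => ?_)
    simp
  refine ⟨hex, ?_⟩
  have hle : ‖(φ ⋆[ContinuousLinearMap.lsmul ℝ ℝ, volume] f) x‖ ≤ ∫ y, ‖φ y‖ * ‖f (x - y)‖ := by
    refine (norm_integral_le_integral_norm _).trans (le_of_eq (integral_congr_ae ?_))
    exact Eventually.of_forall fun y => by simp
  -- Cauchy-Schwarz through the discriminant of the nonnegative quadratic `t ↦ ∫ ‖φ y‖ (t - ‖f (x -
  -- y)‖)²`.
  have hdisc := discrim_le_zero (a := ∫ y, ‖φ y‖) (b := -2 * ∫ y, ‖φ y‖ * ‖f (x - y)‖)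
    (c := ∫ y, ‖φ y‖ * ‖f (x - y)‖ ^ 2) fun t => by
      have : 0 ≤ ∫ y, (‖φ y‖ * (t * t) + (-2 * t) * (‖φ y‖ * ‖f (x - y)‖)
          + ‖φ y‖ * ‖f (x - y)‖ ^ 2) := by
        refine integral_nonneg fun y => ?_
        have := mul_nonneg (norm_nonneg (φ y)) (sq_nonneg (t - ‖f (x - y)‖))
        simp only [Pi.zero_apply]
        linarith
      have i1 := hN.mul_const (t * t)
      have i2 := hc.const_mul (-2 * t)
      have i3 : Integrable (fun y => ‖φ y‖ * (t * t) + (-2 * t) * (‖φ y‖ * ‖f (x - y)‖)) volume :=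
        i1.add i2
      rw [integral_add i3 hS, integral_add i1 i2, integral_mul_const, integral_const_mul] at this
      linarith
  have hconv : ((fun y => ‖φ y‖) ⋆[ContinuousLinearMap.mul ℝ ℝ, volume] fun y => ‖f y‖ ^ 2) x
      = ∫ y, ‖φ y‖ * ‖f (x - y)‖ ^ 2 := rfl
  rw [hconv]
  have := pow_le_pow_left₀ (norm_nonneg _) hle 2
  rw [discrim] at hdisc
  linarith

theorem memLp_convolution {φ : Space n → ℝ} {f : Space n → ℂ}
    (hφ : Integrable φ volume) (hf : MemLp f 2 volume) :
    MemLp (φ ⋆[ContinuousLinearMap.lsmul ℝ ℝ, volume] f) 2 volume := by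
  have hm := aestronglyMeasurable_convolution hφ hf.1
  rw [memLp_two_iff_integrable_sq_norm hm]
  refine ((hφ.norm.integrable_convolution (ContinuousLinearMap.mul ℝ ℝ)
    ((memLp_two_iff_integrable_sq_norm hf.1).1 hf)).const_mul (∫ y, ‖φ y‖)).mono'
    (hm.norm.pow 2) ?_
  filter_upwards [ae_convolutionExistsAt_and_sq_norm_convolution_le hφ hf] with x hx
  rw [Real.norm_of_nonneg (by positivity)]
  exact hx.2

theorem integral_sq_norm_convolution_le {φ : Space n → ℝ} {f : Space n → ℂ}
    (hφ : Integrable φ volume) (hf : MemLp f 2 volume) :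
    ∫ x, ‖(φ ⋆[ContinuousLinearMap.lsmul ℝ ℝ, volume] f) x‖ ^ 2 ≤
      (∫ y, ‖φ y‖) ^ 2 * ∫ y, ‖f y‖ ^ 2 := by
  have hm := memLp_convolution hφ hf
  have hf2 := (memLp_two_iff_integrable_sq_norm hf.1).1 hf
  calc ∫ x, ‖(φ ⋆[ContinuousLinearMap.lsmul ℝ ℝ, volume] f) x‖ ^ 2
      ≤ ∫ x, (∫ y, ‖φ y‖) *
          ((fun y => ‖φ y‖) ⋆[ContinuousLinearMap.mul ℝ ℝ, volume] fun y => ‖f y‖ ^ 2) x := by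
        refine integral_mono_ae ((memLp_two_iff_integrable_sq_norm hm.1).1 hm)
          ((hφ.norm.integrable_convolution _ hf2).const_mul _) ?_
        filter_upwards [ae_convolutionExistsAt_and_sq_norm_convolution_le hφ hf] with x hx
        exact hx.2
    _ = (∫ y, ‖φ y‖) ^ 2 * ∫ y, ‖f y‖ ^ 2 := by
        rw [integral_const_mul, integral_convolution _ hφ.norm hf2, ContinuousLinearMap.mul_apply']
        ring

theorem norm_sq_eq_integral (f : L2 n) : ‖f‖ ^ 2 = ∫ x, ‖f x‖ ^ 2 := by
  have h := congrArg RCLike.re (L2.inner_def (𝕜 := ℂ) f f)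
  rw [inner_self_eq_norm_sq] at h
  rw [h, ← integral_re (L2.integrable_inner f f)]
  exact integral_congr_ae (Eventually.of_forall fun x => inner_self_eq_norm_sq _)

/-- Convolution with an integrable function as a bounded operator on `L²`. -/
def convolutionL2 (φ : Space n → ℝ) (hφ : Integrable φ volume) : L2 n →L[ℂ] L2 n :=
  LinearMap.mkContinuous
    { toFun := fun f => (memLp_convolution hφ (Lp.memLp f)).toLp
      map_add' := fun f g => by
        rw [← MemLp.toLp_add, MemLp.toLp_eq_toLp_iff,
          convolution_congr _ (Filter.EventuallyEq.refl _ φ) (Lp.coeFn_add f g)]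
        filter_upwards [ae_convolutionExistsAt_and_sq_norm_convolution_le hφ (Lp.memLp f),
          ae_convolutionExistsAt_and_sq_norm_convolution_le hφ (Lp.memLp g)] with x h1 h2
        exact h1.1.distrib_add h2.1
      map_smul' := fun c f => by
        rw [RingHom.id_apply, ← MemLp.toLp_const_smul, MemLp.toLp_eq_toLp_iff,
          convolution_congr _ (Filter.EventuallyEq.refl _ φ) (Lp.coeFn_smul c f)]
        refine Eventually.of_forall fun x => ?_
        simp only [convolution_def, Pi.smul_apply, ContinuousLinearMap.lsmul_apply,
          smul_comm _ c, integral_smul] }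
    (∫ y, ‖φ y‖) fun f => by
      have h0 : 0 ≤ ∫ y, ‖φ y‖ := integral_nonneg fun _ => norm_nonneg _
      refine le_of_sq_le_sq ?_ (by positivity)
      rw [mul_pow, norm_sq_eq_integral, norm_sq_eq_integral]
      refine le_trans (le_of_eq (integral_congr_ae ?_))
        (integral_sq_norm_convolution_le hφ (Lp.memLp f))
      filter_upwards [(memLp_convolution hφ (Lp.memLp f)).coeFn_toLp] with x hx
      exact congrArg (fun z => ‖z‖ ^ 2) hx

theorem coeFn_convolutionL2 {φ : Space n → ℝ} (hφ : Integrable φ volume) (f : L2 n) :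
    convolutionL2 φ hφ f =ᵐ[volume] φ ⋆[ContinuousLinearMap.lsmul ℝ ℝ, volume] f :=
  (memLp_convolution hφ (Lp.memLp f)).coeFn_toLp

/-! ### Mollification as a Fourier multiplier -/

theorem continuous_fourier {f : Space n → ℂ} (hf : Integrable f volume) : Continuous (𝓕 f) :=
  VectorFourier.fourierIntegral_continuous Real.continuous_fourierChar continuous_inner hf

theorem norm_fourier_le (f : Space n → ℂ) (ξ : Space n) : ‖𝓕 f ξ‖ ≤ ∫ x, ‖f x‖ :=
  VectorFourier.norm_fourierIntegral_le_integral_norm _ _ _ _ _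

/-- On `L¹ ∩ L²` the Plancherel transform is the Fourier integral. -/
theorem fourier_toLp_ae_eq {f : Space n → ℂ} (hf : Integrable f volume) (hf2 : MemLp f 2 volume) :
    (𝓕 (hf2.toLp f) : L2 n) =ᵐ[volume] 𝓕 f := by
  -- Both transforms are tested against smooth compactly supported functions; each lets the
  -- transform be moved onto the test function.
  refine ae_eq_of_integral_contDiff_smul_eq ((Lp.memLp _).locallyIntegrable one_le_two)
    (continuous_fourier hf).locallyIntegrable fun g g_smooth g_cpt => ?_
  have hg₁ : HasCompactSupport (Complex.ofRealCLM ∘ g) := g_cpt.comp_left rfl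
  have hg₂ : ContDiff ℝ (⊤ : ℕ∞) (Complex.ofRealCLM ∘ g) :=
    Complex.ofRealCLM.contDiff.comp g_smooth
  set G := hg₁.toSchwartzMap hg₂
  have hG : ∀ x, G x = (g x : ℂ) := fun x => rfl
  have h1 := congrArg (fun D => D G) (Lp.fourier_toTemperedDistribution_eq (hf2.toLp f))
  simp only [TemperedDistribution.fourier_apply, Lp.toTemperedDistribution_apply] at h1
  have h2 : ∫ ξ, 𝓕 G ξ • f ξ = ∫ x, G x • 𝓕 f x := by
    simpa using! VectorFourier.integral_bilin_fourierIntegral_eq_flip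
      (ContinuousLinearMap.lsmul ℂ ℂ) (L := innerₗ (Space n))
      Real.continuous_fourierChar continuous_inner G.integrable hf
  have h3 : ∫ x, (𝓕 G) x • (hf2.toLp f) x = ∫ ξ, 𝓕 G ξ • f ξ := by
    refine integral_congr_ae ?_
    filter_upwards [hf2.coeFn_toLp] with x hx
    rw [hx]
  rw [h3, h2] at h1
  simpa [hG] using! h1.symm

theorem integrable_ofReal {φ : Space n → ℝ} (hφ : Integrable φ volume) :
    Integrable (fun x => (φ x : ℂ)) volume :=
  hφ.ofReal

theorem memLp_fourier {f : Space n → ℂ} (hf : Integrable f volume) :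
    MemLp (𝓕 f) ∞ (volume : Measure (Space n)) :=
  memLp_top_of_bound (continuous_fourier hf).aestronglyMeasurable _
    (Eventually.of_forall (norm_fourier_le f))

/-- Both operators are continuous, so it suffices to compare them on the dense Schwartz functions,
where the `L¹` convolution theorem applies. -/
theorem convolutionL2_eq_fourierMultiplier {φ : Space n → ℝ} (hφ : Integrable φ volume) :
    convolutionL2 φ hφ =
      fourierMultiplier (𝓕 fun x => (φ x : ℂ)) (memLp_fourier (integrable_ofReal hφ)) := by
  apply ContinuousLinearMap.coeFn_injective
  refine DenseRange.equalizer (SchwartzMap.denseRange_toLpCLM (p := 2) ENNReal.ofNat_ne_top)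
    (ContinuousLinearMap.continuous _) (ContinuousLinearMap.continuous _) (funext fun f => ?_)
  simp only [Function.comp_apply, SchwartzMap.toLpCLM_apply]
  have hf : MemLp f 2 (volume : Measure (Space n)) := f.memLp 2
  apply (Lp.fourierTransformₗᵢ (Space n) ℂ).injective
  change (𝓕 (convolutionL2 φ hφ (f.toLp 2)) : L2 n) = 𝓕 (fourierMultiplier _ _ (f.toLp 2))
  have hc : convolutionL2 φ hφ (f.toLp 2) = (memLp_convolution hφ hf).toLp := by
    apply Lp.ext
    refine (coeFn_convolutionL2 hφ _).trans ?_
    rw [convolution_congr _ (Filter.EventuallyEq.refl _ φ) (f.coeFn_toLp 2 volume)]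
    exact (memLp_convolution hφ hf).coeFn_toLp.symm
  apply Lp.ext
  rw [hc]
  have hint : Integrable (φ ⋆[ContinuousLinearMap.lsmul ℝ ℝ, volume] f) volume :=
    hφ.integrable_convolution _ f.integrable
  filter_upwards [fourier_toLp_ae_eq hint (memLp_convolution hφ hf),
    fourier_fourierMultiplier _ (memLp_fourier (integrable_ofReal hφ)) (f.toLp 2),
    (𝓕 f).coeFn_toLp 2 volume] with ξ h1 h2 h3
  rw [h1, h2, SchwartzMap.toLp_fourier_eq, h3, SchwartzMap.fourier_coe, ← smul_eq_mul,
    ← Real.fourier_smul_convolution_eq (integrable_ofReal hφ) f.integrable]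
  congr 1

theorem integrable_dilate {φ : Space n → ℝ} (hφ : Integrable φ volume) {β : ℝ} (hβ : 0 < β) :
    Integrable (dilate φ β) volume :=
  (hφ.comp_smul (inv_ne_zero hβ.ne')).const_mul _

theorem fourier_dilate (φ : Space n → ℝ) {β : ℝ} (hβ : 0 < β) (ξ : Space n) :
    𝓕 (fun x => (dilate φ β x : ℂ)) ξ = 𝓕 (fun x => (φ x : ℂ)) (β • ξ) := by
  rw [Real.fourier_eq, Real.fourier_eq]
  have h := Measure.integral_comp_smul (volume : Measure (Space n))
    (fun x => Real.fourierChar (-inner ℝ x (β • ξ)) • (φ x : ℂ)) β⁻¹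
  rw [finrank_euclideanSpace_fin, inv_pow, inv_inv, abs_of_pos (by positivity)] at h
  rw [← inv_smul_eq_iff₀ (by positivity : β ^ n ≠ 0), ← integral_smul] at h
  rw [← h]
  refine integral_congr_ae (Eventually.of_forall fun x => ?_)
  simp only [inner_smul_left, inner_smul_right, dilate, Circle.smul_def, smul_eq_mul,
    Complex.real_smul]
  rw [show β * ((starRingEnd ℝ) β⁻¹ * inner ℝ x ξ) = inner ℝ x ξ by
    rw [conj_trivial, ← mul_assoc, mul_inv_cancel₀ hβ.ne', one_mul]]
  push_cast
  ring

theorem memLp_one_sub_fourier {φ : Space n → ℝ} (hφ : Integrable φ volume) (β : ℝ) :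
    MemLp (fun ξ => 1 - 𝓕 (fun x => (φ x : ℂ)) (β • ξ)) ∞ (volume : Measure (Space n)) := by
  have hc := continuous_fourier (integrable_ofReal hφ)
  refine memLp_top_of_bound (Continuous.aestronglyMeasurable (by fun_prop))
    (1 + ∫ x, ‖(φ x : ℂ)‖) (Eventually.of_forall fun ξ => ?_)
  refine (norm_sub_le _ _).trans ?_
  rw [norm_one]
  gcongr
  exact norm_fourier_le _ _

theorem sub_mollify_ae_eq {φ : Space n → ℝ} (hφ : Integrable φ volume) {β : ℝ} (hβ : 0 < β)
    (f : L2 n) :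
    (fun x => f x - mollify φ β f x) =ᵐ[volume]
      fourierMultiplier _ (memLp_one_sub_fourier hφ β) f := by
  have key : fourierMultiplier _ (memLp_one_sub_fourier hφ β) f =
      f - convolutionL2 _ (integrable_dilate hφ hβ) f := by
    rw [convolutionL2_eq_fourierMultiplier]
    apply (Lp.fourierTransformₗᵢ (Space n) ℂ).injective
    rw [map_sub]
    change (𝓕 (fourierMultiplier _ _ f) : L2 n) = 𝓕 f - 𝓕 (fourierMultiplier _ _ f)
    apply Lp.ext
    filter_upwards [fourier_fourierMultiplier _ (memLp_one_sub_fourier hφ β) f,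
      fourier_fourierMultiplier _ (memLp_fourier (integrable_ofReal (integrable_dilate hφ hβ))) f,
      Lp.coeFn_sub (𝓕 f : L2 n) (𝓕 (fourierMultiplier _
        (memLp_fourier (integrable_ofReal (integrable_dilate hφ hβ))) f))] with ξ h1 h2 h3
    rw [h1, h3, Pi.sub_apply, h2, fourier_dilate φ hβ]
    ring
  rw [key]
  filter_upwards [Lp.coeFn_sub f (convolutionL2 _ (integrable_dilate hφ hβ) f),
    coeFn_convolutionL2 (integrable_dilate hφ hβ) f] with x h1 h2
  rw [h1, Pi.sub_apply, h2]
  rfl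

/-! ### Pointwise bounds on symbols -/

/-- Two-sided bounds for `1 - φ̂`: the behaviour at the origin is given, and away from it
`1 - φ̂` is bounded below by the Riemann-Lebesgue lemma and compactness. -/
theorem exists_bounds_one_sub_fourier {φ : Space n → ℝ} (hφ : Integrable φ volume)
    (hφlt : ∀ ξ : Space n, ξ ≠ 0 → ‖𝓕 (fun x => (φ x : ℂ)) ξ‖ < 1) {s : ℝ} (hs : 0 < s)
    (hφs : (fun ξ : Space n => ‖1 - 𝓕 (fun x => (φ x : ℂ)) ξ‖) =Θ[𝓝 0] fun ξ => ‖ξ‖ ^ s) :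
    ∃ c > 0, ∃ C > 0, ∀ ξ : Space n,
      ‖1 - 𝓕 (fun x => (φ x : ℂ)) ξ‖ ≤ C * ‖ξ‖ ^ s ∧
      c * min 1 (‖ξ‖ ^ s) ≤ ‖1 - 𝓕 (fun x => (φ x : ℂ)) ξ‖ := by
  set m : Space n → ℂ := fun ξ => 1 - 𝓕 (fun x => (φ x : ℂ)) ξ with hm
  have hcont : Continuous m := continuous_const.sub (continuous_fourier (integrable_ofReal hφ))
  obtain ⟨C₁, hC₁, h₁⟩ := hφs.1.exists_pos
  obtain ⟨C₂, hC₂, h₂⟩ := hφs.2.exists_pos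
  obtain ⟨r, hr, hball⟩ := Metric.eventually_nhds_iff.1 (h₁.bound.and h₂.bound)
  have hpos : ∀ ξ : Space n, 0 ≤ ‖ξ‖ ^ s := fun ξ => Real.rpow_nonneg (norm_nonneg _) _
  obtain ⟨c₀, hc₀, hfar⟩ : ∃ c₀ > 0, ∀ ξ : Space n, r ≤ ‖ξ‖ → c₀ ≤ ‖m ξ‖ := by
    have hRL : Tendsto (𝓕 (fun x => (φ x : ℂ))) (cocompact (Space n)) (𝓝 0) :=
      tendsto_integral_exp_inner_smul_cocompact _
    have hev := (NormedAddGroup.tendsto_nhds_zero.1 hRL) (1 / 2) (by norm_num)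
    obtain ⟨K, hK, hKsub⟩ := mem_cocompact.1 hev
    have hS : IsCompact (K ∩ {ξ : Space n | r ≤ ‖ξ‖}) :=
      hK.inter_right (isClosed_le continuous_const continuous_norm)
    have hKhalf : ∀ ξ : Space n, ξ ∉ K → 1 / 2 ≤ ‖m ξ‖ := fun ξ hξ => by
      have h := hKsub hξ
      have h' := norm_sub_norm_le (1 : ℂ) (𝓕 (fun x => (φ x : ℂ)) ξ)
      simp only [mem_ofPred_eq, norm_one] at h h'
      linarith
    have hne : ∀ ξ : Space n, r ≤ ‖ξ‖ → 0 < ‖m ξ‖ := fun ξ hξ => by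
      have h := hφlt ξ (norm_pos_iff.1 (hr.trans_le hξ))
      have h' := norm_sub_norm_le (1 : ℂ) (𝓕 (fun x => (φ x : ℂ)) ξ)
      rw [norm_one] at h'
      exact lt_of_lt_of_le (by linarith) h'
    -- The compact set may be empty, for instance when `n = 0`; then no minimum exists and the bound
    -- off `K` suffices.
    rcases (K ∩ {ξ : Space n | r ≤ ‖ξ‖}).eq_empty_or_nonempty with he | hn
    · refine ⟨1 / 2, by norm_num, fun ξ hξ => hKhalf ξ fun hξK => ?_⟩
      exact (he ▸ (⟨hξK, hξ⟩ : ξ ∈ K ∩ {ξ : Space n | r ≤ ‖ξ‖}) : ξ ∈ (∅ : Set (Space n)))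
    · obtain ⟨ξ₀, hξ₀, hmin⟩ := hS.exists_isMinOn hn hcont.norm.continuousOn
      refine ⟨min (1 / 2) ‖m ξ₀‖, lt_min (by norm_num) (hne ξ₀ hξ₀.2), fun ξ hξ => ?_⟩
      by_cases hξK : ξ ∈ K
      · exact (min_le_right _ _).trans (hmin ⟨hξK, hξ⟩)
      · exact (min_le_left _ _).trans (hKhalf ξ hξK)
  set M := 1 + ∫ x, ‖(φ x : ℂ)‖ with hM
  have hM0 : 0 < M := by
    have : 0 ≤ ∫ x, ‖(φ x : ℂ)‖ := integral_nonneg fun _ => norm_nonneg _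
    positivity
  have hmM : ∀ ξ, ‖m ξ‖ ≤ M := fun ξ => (norm_sub_le _ _).trans (by
    rw [norm_one, hM]; gcongr; exact norm_fourier_le _ _)
  have hrs : 0 < r ^ s := Real.rpow_pos_of_pos hr s
  -- The lower bound is capped at `1` because `1 - φ̂` stays bounded. Beyond radius `r` the upper
  -- bound is `M ≤ (M / r^s) ‖ξ‖^s`.
  refine ⟨min c₀ (1 / C₂), lt_min hc₀ (by positivity), max C₁ (M / r ^ s),
    lt_max_of_lt_left hC₁, fun ξ => ?_⟩
  have hmin0 : 0 ≤ min 1 (‖ξ‖ ^ s) := le_min zero_le_one (hpos ξ)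
  rcases lt_or_ge ‖ξ‖ r with hξ | hξ
  · have hb := hball (y := ξ) (by rwa [dist_zero_right])
    simp only [norm_norm, Real.norm_of_nonneg (hpos ξ)] at hb
    refine ⟨hb.1.trans (mul_le_mul_of_nonneg_right (le_max_left _ _) (hpos ξ)), ?_⟩
    calc min c₀ (1 / C₂) * min 1 (‖ξ‖ ^ s) ≤ 1 / C₂ * ‖ξ‖ ^ s :=
          mul_le_mul (min_le_right _ _) (min_le_right _ _) hmin0 (by positivity)
      _ ≤ ‖m ξ‖ := by rw [one_div, inv_mul_le_iff₀ hC₂]; exact hb.2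
  · constructor
    · refine (hmM ξ).trans ?_
      calc M = M / r ^ s * r ^ s := by field_simp
        _ ≤ max C₁ (M / r ^ s) * ‖ξ‖ ^ s :=
          mul_le_mul (le_max_right _ _) (Real.rpow_le_rpow hr.le hξ hs.le) hrs.le
            (le_max_of_le_left hC₁.le)
    · calc min c₀ (1 / C₂) * min 1 (‖ξ‖ ^ s) ≤ c₀ * 1 :=
          mul_le_mul (min_le_left _ _) (min_le_left _ _) hmin0 hc₀.le
        _ ≤ ‖m ξ‖ := by rw [mul_one]; exact hfar ξ hξ

/-- The operator norm of a Fourier multiplier dominates its symbol almost everywhere. -/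
theorem norm_symbol_le_of_opNorm_le {B : L2 n →L[ℂ] L2 n} {m : Space n → ℂ}
    (hm : AEStronglyMeasurable m volume)
    (hB : ∀ f : L2 n, (𝓕 (B f) : L2 n) =ᵐ[volume] fun ξ => m ξ * (𝓕 f : L2 n) ξ)
    {h : ℝ} (hBh : ‖B‖ ≤ h) : ∀ᵐ ξ, ‖m ξ‖ ≤ h := by
  have h0 : 0 ≤ h := (norm_nonneg _).trans hBh
  set m' := hm.mk m
  have hm' : StronglyMeasurable m' := hm.stronglyMeasurable_mk
  suffices hs : ∀ᵐ ξ, ‖m' ξ‖ ≤ h by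
    filter_upwards [hs, hm.ae_eq_mk] with ξ h1 h2
    rw [h2]; exact h1
  have hmeas : MeasurableSet {ξ | h < ‖m' ξ‖} :=
    measurableSet_lt measurable_const hm'.norm.measurable
  -- Inside a ball the exceptional set `S` has finite measure, so its indicator is the transform of
  -- some `f` in `L²`. If `S` had positive measure, this `f` would violate the operator norm bound.
  have hzero : ∀ k : ℕ, volume ({ξ | h < ‖m' ξ‖} ∩ Metric.ball (0 : Space n) k) = 0 := by
    intro k
    set S := {ξ | h < ‖m' ξ‖} ∩ Metric.ball (0 : Space n) k with hS
    have hSm : MeasurableSet S := hmeas.inter Metric.isOpen_ball.measurableSet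
    have hSfin : volume S ≠ ∞ :=
      ((measure_mono inter_subset_right).trans_lt Metric.isBounded_ball.measure_lt_top).ne
    set g : L2 n := indicatorConstLp 2 hSm hSfin (1 : ℂ)
    set f : L2 n := (Lp.fourierTransformₗᵢ (Space n) ℂ).symm g
    have hf : (𝓕 f : L2 n) = g := (Lp.fourierTransformₗᵢ (Space n) ℂ).apply_symm_apply g
    have hle : ‖(𝓕 (B f) : L2 n)‖ ≤ h * ‖g‖ := by
      rw [Lp.norm_fourier_eq, ← hf, Lp.norm_fourier_eq]
      exact (B.le_opNorm f).trans (mul_le_mul_of_nonneg_right hBh (norm_nonneg _))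
    have hsq := pow_le_pow_left₀ (norm_nonneg _) hle 2
    rw [mul_pow, norm_sq_eq_integral, norm_sq_eq_integral g, ← integral_const_mul] at hsq
    have hi1 := (memLp_two_iff_integrable_sq_norm (Lp.memLp (𝓕 (B f) : L2 n)).1).1 (Lp.memLp _)
    have hi2 := ((memLp_two_iff_integrable_sq_norm (Lp.memLp g).1).1 (Lp.memLp _)).const_mul (h ^ 2)
    have hae : ∀ᵐ ξ, (𝓕 (B f) : L2 n) ξ = m' ξ * g ξ ∧ g ξ = S.indicator (fun _ => 1) ξ := by
      filter_upwards [hB f, hm.ae_eq_mk,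
        indicatorConstLp_coeFn (p := 2) (hs := hSm) (hμs := hSfin) (c := (1 : ℂ))] with ξ h1 h2 h3
      rw [h1, hf, h2]
      exact ⟨rfl, h3⟩
    have hnn : 0 ≤ᵐ[volume] fun ξ => ‖(𝓕 (B f) : L2 n) ξ‖ ^ 2 - h ^ 2 * ‖g ξ‖ ^ 2 := by
      filter_upwards [hae] with ξ hξ
      rw [Pi.zero_apply, hξ.1, hξ.2]
      by_cases hmem : ξ ∈ S
      · have : h < ‖m' ξ‖ := hmem.1
        simp only [indicator_of_mem hmem, mul_one, norm_one, one_pow]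
        nlinarith
      · simp [indicator_of_notMem hmem]
    have hint0 : ∫ ξ, (‖(𝓕 (B f) : L2 n) ξ‖ ^ 2 - h ^ 2 * ‖g ξ‖ ^ 2) = 0 := by
      refine le_antisymm ?_ (integral_nonneg_of_ae hnn)
      rw [integral_sub hi1 hi2]
      linarith
    have hz := (integral_eq_zero_iff_of_nonneg_ae hnn (hi1.sub hi2)).1 hint0
    have hnot : ∀ᵐ ξ, ξ ∉ S := by
      filter_upwards [hae, hz] with ξ h1 h2 hmem
      have : h < ‖m' ξ‖ := hmem.1
      simp only [h1.1, h1.2, indicator_of_mem hmem, mul_one, norm_one, one_pow, Pi.zero_apply] at h2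
      nlinarith
    exact measure_eq_zero_iff_ae_notMem.2 hnot
  have hunion : volume {ξ | h < ‖m' ξ‖} = 0 := by
    have : {ξ | h < ‖m' ξ‖} = ⋃ k : ℕ, {ξ | h < ‖m' ξ‖} ∩ Metric.ball (0 : Space n) k := by
      rw [← inter_iUnion, Metric.iUnion_ball_nat, inter_univ]
    rw [this]
    exact measure_iUnion_null hzero
  filter_upwards [measure_eq_zero_iff_ae_notMem.1 hunion] with ξ hξ
  exact not_lt.1 hξ

/-! ### Scalar estimates for the regularized inverse and the filter -/

theorem rpow_mul_exp_neg_le {a b L : ℝ} (ha : 0 < a) (hb : 0 < b) (hL : 0 ≤ L) :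
    L ^ a * Real.exp (-(b * L)) ≤ (a / b) ^ a := by
  have h1 : L ≤ a / b * Real.exp (b * L / a) := by
    have h := Real.add_one_le_exp (b * L / a)
    calc L = a / b * (b * L / a) := by field_simp
      _ ≤ a / b * Real.exp (b * L / a) := by gcongr; linarith
  have h2 : L ^ a ≤ (a / b) ^ a * Real.exp (b * L) := by
    refine (Real.rpow_le_rpow hL h1 ha.le).trans (le_of_eq ?_)
    rw [Real.mul_rpow (by positivity) (Real.exp_pos _).le, ← Real.exp_mul, div_mul_cancel₀ _ ha.ne']
  rw [Real.exp_neg, ← div_eq_mul_inv, div_le_iff₀ (Real.exp_pos _)]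
  exact h2

/-- Trades a power of `ε = exp (-L)` for the logarithmic rate. -/
theorem exp_neg_le_mul_rpow_neg {a b L : ℝ} (ha : 0 < a) (hb : 0 < b) (hL : 0 < L) :
    Real.exp (-(b * L)) ≤ (a / b) ^ a * L ^ (-a) := by
  have h := rpow_mul_exp_neg_le ha hb hL.le
  have hLa : 0 < L ^ a := Real.rpow_pos_of_pos hL a
  rw [Real.rpow_neg hL.le, ← div_eq_mul_inv, le_div_iff₀ hLa, mul_comm]
  exact h

/-- Low frequencies carry a bounded forward symbol, the others a bounded regularizing one. -/
theorem exists_bound_regularized_inverse {τ Γ s c η : ℝ} (hτ : 0 < τ) (hs : 0 < s) (hc : 0 < c)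
    (hη1 : η < 1) :
    ∃ K > 0, ∀ L > 0, Real.exp (-L) ≤ η → ∀ x ≥ 0, ∀ P μ : ℝ,
      Real.exp (-((2 * Real.pi * x) ^ (2 * τ) * Γ)) - Real.exp (-L) ≤ P → 0 ≤ P → 0 ≤ μ →
      c * min 1 (Real.exp (-(1 / 2 * L)) * x ^ s) ≤ μ →
      0 < P ^ 2 + μ ^ 2 ∧ P / (P ^ 2 + μ ^ 2) ≤ K * Real.exp (1 / 2 * L) := by
  -- The radius depends on `η` but not on `L`: subtracting `exp (-L) ≤ η` from more than `(1 + η) /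
  -- 2` leaves at least `d = (1 - η) / 2`.
  obtain ⟨r, hr, hlow⟩ : ∃ r > 0, ∀ x : ℝ, 0 ≤ x → x < r →
      (1 + η) / 2 < Real.exp (-((2 * Real.pi * x) ^ (2 * τ) * Γ)) := by
    have hcont : Continuous fun x : ℝ => Real.exp (-((2 * Real.pi * x) ^ (2 * τ) * Γ)) :=
      Real.continuous_exp.comp (((continuous_const.mul continuous_id).rpow_const
        fun _ => Or.inr (by positivity)).mul continuous_const).neg
    have h0 : (1 + η) / 2 < Real.exp (-((2 * Real.pi * (0 : ℝ)) ^ (2 * τ) * Γ)) := by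
      rw [mul_zero, Real.zero_rpow (by positivity), zero_mul, neg_zero, Real.exp_zero]
      linarith
    obtain ⟨r, hr, hb⟩ := Metric.eventually_nhds_iff.1
      (hcont.continuousAt.eventually (lt_mem_nhds h0))
    exact ⟨r, hr, fun x hx hxr => hb (by rwa [Real.dist_eq, sub_zero, abs_of_nonneg hx])⟩
  set d := (1 - η) / 2
  have hd : 0 < d := by simp only [d]; linarith
  set e := c * min 1 (r ^ s)
  have he : 0 < e := mul_pos hc (lt_min one_pos (Real.rpow_pos_of_pos hr s))
  refine ⟨1 / d + 1 / e, by positivity, fun L hL hLη x hx P μ hP hP0 hμ0 hμ => ?_⟩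
  have hexp : 1 ≤ Real.exp (1 / 2 * L) := Real.one_le_exp (by positivity)
  rcases lt_or_ge x r with hxr | hxr
  · have hPd : d ≤ P := by have := hlow x hx hxr; simp only [d]; linarith
    have hPpos : 0 < P := hd.trans_le hPd
    refine ⟨by positivity, ?_⟩
    calc P / (P ^ 2 + μ ^ 2) ≤ 1 / d := by
          rw [div_le_div_iff₀ (by positivity) hd]; nlinarith [sq_nonneg μ]
      _ ≤ (1 / d + 1 / e) * 1 := by rw [mul_one]; linarith [show 0 < 1 / e by positivity]
      _ ≤ _ := by gcongr
  · set w := Real.exp (-(1 / 2 * L)) with hw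
    have hw0 : 0 < w := Real.exp_pos _
    have hw1 : w ≤ 1 := Real.exp_le_one_iff.2 (by linarith)
    have hμe : e * w ≤ μ := by
      refine le_trans ?_ hμ
      rw [mul_assoc]
      gcongr
      refine le_min ?_ ?_
      · exact (mul_le_mul (min_le_left _ _) hw1 hw0.le zero_le_one).trans (by simp)
      · rw [mul_comm]
        gcongr
        exact (min_le_right _ _).trans (Real.rpow_le_rpow hr.le hxr hs.le)
    have hμpos : 0 < μ := lt_of_lt_of_le (by positivity) hμe
    refine ⟨by positivity, ?_⟩
    have hexpw : Real.exp (1 / 2 * L) = 1 / w := by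
      rw [hw, Real.exp_neg, div_inv_eq_mul, one_mul]
    -- From `P * μ ≤ P² + μ²` and `e * w ≤ μ`.
    calc P / (P ^ 2 + μ ^ 2) ≤ 1 / (e * w) := by
          rw [div_le_div_iff₀ (by positivity) (by positivity)]
          nlinarith [sq_nonneg (P - μ), mul_le_mul_of_nonneg_left hμe hP0]
      _ = 1 / e * (1 / w) := by field_simp
      _ ≤ (1 / d + 1 / e) * Real.exp (1 / 2 * L) := by
          rw [hexpw]; gcongr; linarith [show 0 < 1 / d by positivity]

/-- The logarithmic convergence rate: for `|ξ| ≤ κ L^{1/2τ}` the forward symbol dominates, beyond that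
the Sobolev weight does. -/
theorem exists_bound_filter {τ Γ s C p η : ℝ} (hτ : 0 < τ) (hΓ : 0 ≤ Γ) (hs : 0 < s)
    (hC : 0 < C) (hp : 0 < p) (hη : 0 < η) (hη1 : η < 1) :
    ∃ K > 0, ∀ L > 0, Real.exp (-L) ≤ η → ∀ x ≥ 0, ∀ P μ : ℝ,
      Real.exp (-((2 * Real.pi * x) ^ (2 * τ) * Γ)) - Real.exp (-L) ≤ P → 0 ≤ μ →
      μ ≤ C * (Real.exp (-(1 / 2 * L)) * x ^ s) → 0 < P ^ 2 + μ ^ 2 →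
      μ ^ 2 / (P ^ 2 + μ ^ 2) ≤ K * L ^ (-(p / (2 * τ))) * (1 + x ^ 2) ^ (p / 2) := by
  set q := p / (2 * τ) with hq
  have hq0 : 0 < q := by positivity
  -- Chosen so that `x ≤ κ L^{1/(2τ)}` makes the heat exponent at most `L / 4`; `Γ + 1` keeps the
  -- inverse meaningful if `Γ = 0`.
  set κ := ((4 * (Γ + 1))⁻¹) ^ (1 / (2 * τ)) / (2 * Real.pi) with hκ
  have hκ0 : 0 < κ := by positivity
  have hκτ : (2 * Real.pi * κ) ^ (2 * τ) = (4 * (Γ + 1))⁻¹ := by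
    rw [hκ, mul_div_cancel₀ _ (by positivity), ← Real.rpow_mul (by positivity),
      one_div_mul_cancel (by positivity), Real.rpow_one]
  -- Lower bound for `1 - exp (-3L/4)`, the factor left in `exp (-L/4) - exp (-L)`.
  set g := 1 - η ^ (3 / 4 : ℝ) with hg
  have hg0 : 0 < g := sub_pos.2 (Real.rpow_lt_one hη.le hη1 (by norm_num))
  -- The squared ratio `μ / P` is `O(exp (-L/2) L^{s/τ})`; the extra `s / τ` in the exponent absorbs
  -- that growth.
  set A := ((q + s / τ) / (1 / 2)) ^ (q + s / τ) with hA
  have hA0 : 0 < A := by positivity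
  set K₂ := (C / g) ^ 2 * κ ^ (2 * s) * A with hK₂
  have hK₂0 : 0 < K₂ := by positivity
  refine ⟨κ ^ (-p) + K₂, by positivity, fun L hL hLη x hx P μ hP hμ0 hμ hD => ?_⟩
  have hLq : 0 < L ^ (-q) := Real.rpow_pos_of_pos hL _
  have hκp : 0 < κ ^ (-p) := Real.rpow_pos_of_pos hκ0 _
  have hwt : 1 ≤ (1 + x ^ 2) ^ (p / 2) :=
    Real.one_le_rpow (by nlinarith [sq_nonneg x]) (by positivity)
  set R := κ * L ^ (1 / (2 * τ)) with hR
  have hR0 : 0 < R := by positivity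
  rcases le_or_gt R x with hRx | hxR
  · have h1 : R ^ p ≤ (1 + x ^ 2) ^ (p / 2) := by
      calc R ^ p ≤ x ^ p := Real.rpow_le_rpow hR0.le hRx hp.le
        _ = (x ^ 2) ^ (p / 2) := by
            rw [← Real.rpow_natCast, ← Real.rpow_mul hx]; congr 1; push_cast; ring
        _ ≤ _ := Real.rpow_le_rpow (sq_nonneg x) (by linarith) (by positivity)
    have h2 : R ^ p = κ ^ p * L ^ q := by
      rw [hR, Real.mul_rpow hκ0.le (by positivity), ← Real.rpow_mul hL.le]
      congr 2; rw [hq]; field_simp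
    calc μ ^ 2 / (P ^ 2 + μ ^ 2) ≤ 1 := by
          rw [div_le_one hD]; linarith [sq_nonneg P]
      _ = κ ^ (-p) * L ^ (-q) * R ^ p := by
          rw [h2, Real.rpow_neg hκ0.le, Real.rpow_neg hL.le]; field_simp
      _ ≤ (κ ^ (-p) + K₂) * L ^ (-q) * (1 + x ^ 2) ^ (p / 2) := by
          gcongr; linarith
  · have hpow : (2 * Real.pi * x) ^ (2 * τ) * Γ ≤ 1 / 4 * L := by
      have h1 : (2 * Real.pi * x) ^ (2 * τ) ≤ (4 * (Γ + 1))⁻¹ * L := by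
        calc (2 * Real.pi * x) ^ (2 * τ) ≤ (2 * Real.pi * κ * L ^ (1 / (2 * τ))) ^ (2 * τ) :=
              Real.rpow_le_rpow (by positivity) (by rw [mul_assoc _ κ]; gcongr) (by positivity)
          _ = (4 * (Γ + 1))⁻¹ * L := by
              rw [Real.mul_rpow (by positivity) (by positivity), hκτ, ← Real.rpow_mul hL.le,
                one_div_mul_cancel (by positivity), Real.rpow_one]
      calc (2 * Real.pi * x) ^ (2 * τ) * Γ ≤ (4 * (Γ + 1))⁻¹ * L * (Γ + 1) := by
            gcongr; linarith
        _ = 1 / 4 * L := by field_simp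
    have hexpg : Real.exp (-(1 / 4 * L)) * g ≤ P := by
      have h1 : Real.exp (-(1 / 4 * L)) ≤ Real.exp (-((2 * Real.pi * x) ^ (2 * τ) * Γ)) :=
        Real.exp_le_exp.2 (neg_le_neg hpow)
      have h2 : Real.exp (-L) = Real.exp (-(1 / 4 * L)) * Real.exp (-L) ^ (3 / 4 : ℝ) := by
        rw [← Real.exp_mul, ← Real.exp_add]; congr 1; ring
      have h3 : Real.exp (-L) ^ (3 / 4 : ℝ) ≤ η ^ (3 / 4 : ℝ) :=
        Real.rpow_le_rpow (Real.exp_pos _).le hLη (by norm_num)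
      have h4 := mul_le_mul_of_nonneg_left h3 (Real.exp_pos (-(1 / 4 * L))).le
      rw [hg, mul_sub, mul_one]
      linarith
    have hP0 : 0 < P := lt_of_lt_of_le (by positivity) hexpg
    have hμR : μ ≤ C * (Real.exp (-(1 / 2 * L)) * R ^ s) := by
      refine hμ.trans ?_
      gcongr
    have hratio : μ / P ≤ C / g * Real.exp (-(1 / 4 * L)) * R ^ s := by
      rw [div_le_iff₀ hP0]
      calc μ ≤ C * (Real.exp (-(1 / 2 * L)) * R ^ s) := hμR
        _ = C / g * Real.exp (-(1 / 4 * L)) * R ^ s * (Real.exp (-(1 / 4 * L)) * g) := by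
            rw [show -(1 / 2 * L) = -(1 / 4 * L) + -(1 / 4 * L) by ring, Real.exp_add]
            field_simp
        _ ≤ _ := by gcongr
    have hRs : (R ^ s) ^ 2 = κ ^ (2 * s) * L ^ (s / τ) := by
      rw [← Real.rpow_natCast, ← Real.rpow_mul hR0.le, hR, Real.mul_rpow hκ0.le (by positivity),
        ← Real.rpow_mul hL.le]
      congr 2
      · push_cast; ring
      · push_cast; field_simp
    have hfinal : (μ / P) ^ 2 ≤ K₂ * L ^ (-q) := by
      have hdec := exp_neg_le_mul_rpow_neg (a := q + s / τ) (b := 1 / 2) (by positivity)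
        (by norm_num) hL
      calc (μ / P) ^ 2 ≤ (C / g * Real.exp (-(1 / 4 * L)) * R ^ s) ^ 2 := by gcongr
        _ = (C / g) ^ 2 * κ ^ (2 * s) * (Real.exp (-(1 / 2 * L)) * L ^ (s / τ)) := by
            rw [mul_pow, mul_pow, hRs, ← Real.exp_nat_mul]
            rw [show ((2 : ℕ) : ℝ) * -(1 / 4 * L) = -(1 / 2 * L) by push_cast; ring]
            ring
        _ ≤ (C / g) ^ 2 * κ ^ (2 * s) * (A * L ^ (-(q + s / τ)) * L ^ (s / τ)) := by gcongr
        _ = K₂ * L ^ (-q) := by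
            rw [hK₂, mul_assoc A, ← Real.rpow_add hL]
            rw [show -(q + s / τ) + s / τ = -q by ring]
            ring
    calc μ ^ 2 / (P ^ 2 + μ ^ 2) ≤ (μ / P) ^ 2 := by
          rw [div_pow]; gcongr; linarith [sq_nonneg μ]
      _ ≤ K₂ * L ^ (-q) * 1 := by rw [mul_one]; exact hfinal
      _ ≤ (κ ^ (-p) + K₂) * L ^ (-q) * (1 + x ^ 2) ^ (p / 2) := by
          gcongr; linarith

/-! ### The minimizer and its error -/

theorem ofReal_norm_eq_eLpNorm (f : L2 n) : ENNReal.ofReal ‖f‖ = eLpNorm f 2 volume := by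
  rw [ofReal_norm, Lp.enorm_def]

theorem fourier_L2_sub (f g : L2 n) : (𝓕 (f - g) : L2 n) = 𝓕 f - 𝓕 g :=
  (Lp.fourierTransformₗᵢ (Space n) ℂ).map_sub f g

theorem fourier_L2_injective {f g : L2 n} (h : (𝓕 f : L2 n) =ᵐ[volume] (𝓕 g : L2 n)) : f = g :=
  (Lp.fourierTransformₗᵢ (Space n) ℂ).injective (Lp.ext h)

theorem mollifiedFunctional_eq {φ : Space n → ℝ} (hφ : Integrable φ volume) {β : ℝ} (hβ : 0 < β)
    (B : L2 n →L[ℂ] L2 n) (g u : L2 n) :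
    mollifiedFunctional φ β B g u = ENNReal.ofReal (‖B u - g‖ ^ 2 +
      ‖fourierMultiplier _ (memLp_one_sub_fourier hφ β) u‖ ^ 2) := by
  rw [mollifiedFunctional, eLpNorm_congr_ae (sub_mollify_ae_eq hφ hβ u),
    ← ofReal_norm_eq_eLpNorm (B u - g), ← ofReal_norm_eq_eLpNorm,
    ENNReal.ofReal_add (by positivity) (by positivity), ENNReal.ofReal_pow (norm_nonneg _),
    ENNReal.ofReal_pow (norm_nonneg _)]

/-- The minimizer of the mollified functional is given on the Fourier side by the symbol
`b̄ / (|b|² + |1 - φ̂_β|²)`. -/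
theorem isReconstruction_iff {φ : Space n → ℝ} (hφ : Integrable φ volume) {β : ℝ} (hβ : 0 < β)
    {B : L2 n →L[ℂ] L2 n} {b m : Space n → ℂ}
    (hm : m = fun ξ => 1 - 𝓕 (fun x => (φ x : ℂ)) (β • ξ))
    (hB : ∀ f : L2 n, (𝓕 (B f) : L2 n) =ᵐ[volume] fun ξ => b ξ * (𝓕 f : L2 n) ξ)
    (hD : ∀ᵐ ξ, 0 < ‖b ξ‖ ^ 2 + ‖m ξ‖ ^ 2)
    (hr : MemLp (fun ξ => (starRingEnd ℂ) (b ξ) / ((‖b ξ‖ ^ 2 + ‖m ξ‖ ^ 2 : ℝ) : ℂ)) ∞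
      (volume : Measure (Space n))) (g w : L2 n) :
    IsReconstruction φ β B g w ↔ w = fourierMultiplier _ hr g := by
  subst hm
  set N := fourierMultiplier _ (memLp_one_sub_fourier hφ β)
  set m : Space n → ℂ := fun ξ => 1 - 𝓕 (fun x => (φ x : ℂ)) (β • ξ)
  have hN : ∀ f : L2 n, (𝓕 (N f) : L2 n) =ᵐ[volume] fun ξ => m ξ * (𝓕 f : L2 n) ξ :=
    fourier_fourierMultiplier _ _
  set v := fourierMultiplier _ hr g
  -- The normal equation in weak form; it makes the functional at `w` exceed its value at `v` by
  -- exactly `‖B (w - v)‖² + ‖N (w - v)‖²`.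
  have hnormal : ∀ d : L2 n, inner ℂ (B v - g) (B d) + inner ℂ (N v) (N d) = (0 : ℂ) := by
    intro d
    rw [← Lp.inner_fourier_eq, ← Lp.inner_fourier_eq (N v), L2.inner_def, L2.inner_def,
      ← integral_add (L2.integrable_inner _ _) (L2.integrable_inner _ _)]
    refine integral_eq_zero_of_ae ?_
    rw [fourier_L2_sub]
    filter_upwards [hB v, hB d, hN v, hN d, Lp.coeFn_sub (𝓕 (B v) : L2 n) (𝓕 g),
      fourier_fourierMultiplier _ hr g, hD] with ξ h1 h2 h3 h4 h5 h6 h7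
    rw [h5, Pi.sub_apply, h1, h2, h3, h4, h6]
    have hne : ((‖b ξ‖ ^ 2 + ‖m ξ‖ ^ 2 : ℝ) : ℂ) ≠ 0 := Complex.ofReal_ne_zero.2 h7.ne'
    have hsum : ((‖b ξ‖ ^ 2 + ‖m ξ‖ ^ 2 : ℝ) : ℂ) =
        (starRingEnd ℂ) (b ξ) * b ξ + (starRingEnd ℂ) (m ξ) * m ξ := by
      rw [Complex.conj_mul', Complex.conj_mul']; push_cast; rfl
    simp only [RCLike.inner_apply, map_sub, map_mul, map_div₀, Complex.conj_conj,
      Complex.conj_ofReal, Pi.zero_apply]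
    field_simp
    rw [hsum]
    ring
  have hpyth : ∀ w : L2 n, ‖B w - g‖ ^ 2 + ‖N w‖ ^ 2 =
      ‖B v - g‖ ^ 2 + ‖N v‖ ^ 2 + (‖B (w - v)‖ ^ 2 + ‖N (w - v)‖ ^ 2) := by
    intro w
    have e1 : B w - g = (B v - g) + B (w - v) := by rw [map_sub]; abel
    have e2 : N w = N v + N (w - v) := by rw [map_sub]; abel
    have h := congrArg RCLike.re (hnormal (w - v))
    rw [map_add, map_zero] at h
    rw [e1, e2, norm_add_sq (𝕜 := ℂ), norm_add_sq (𝕜 := ℂ)]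
    linarith
  constructor
  · intro hw
    have h := hw v
    rw [mollifiedFunctional_eq hφ hβ, mollifiedFunctional_eq hφ hβ,
      ENNReal.ofReal_le_ofReal_iff (by positivity)] at h
    change ‖B w - g‖ ^ 2 + ‖N w‖ ^ 2 ≤ ‖B v - g‖ ^ 2 + ‖N v‖ ^ 2 at h
    rw [hpyth w] at h
    have hBz : ‖B (w - v)‖ ^ 2 = 0 := by nlinarith [sq_nonneg ‖B (w - v)‖, sq_nonneg ‖N (w - v)‖]
    have hNz : ‖N (w - v)‖ ^ 2 = 0 := by nlinarith [sq_nonneg ‖B (w - v)‖, sq_nonneg ‖N (w - v)‖]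
    rw [sq_eq_zero_iff, ← Lp.norm_fourier_eq, norm_eq_zero] at hBz hNz
    apply fourier_L2_injective
    have hB0 := hB (w - v)
    have hN0 := hN (w - v)
    rw [hBz] at hB0
    rw [hNz] at hN0
    have hsub := Lp.coeFn_sub (𝓕 w : L2 n) (𝓕 v)
    rw [← fourier_L2_sub] at hsub
    filter_upwards [hB0, hN0, Lp.coeFn_zero ℂ 2 (volume : Measure (Space n)), hsub, hD]
      with ξ h1 h2 h3 h4 h5
    rw [h3, Pi.zero_apply] at h1 h2
    rw [← sub_eq_zero, ← Pi.sub_apply, ← h4]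
    by_contra hne
    have hb := (mul_eq_zero.1 h1.symm).resolve_right hne
    have hm0 := (mul_eq_zero.1 h2.symm).resolve_right hne
    rw [hb, hm0] at h5
    simp at h5
  · rintro rfl w
    rw [mollifiedFunctional_eq hφ hβ, mollifiedFunctional_eq hφ hβ]
    refine ENNReal.ofReal_le_ofReal ?_
    change ‖B v - g‖ ^ 2 + ‖N v‖ ^ 2 ≤ ‖B w - g‖ ^ 2 + ‖N w‖ ^ 2
    rw [hpyth w]
    linarith [sq_nonneg ‖B (w - v)‖, sq_nonneg ‖N (w - v)‖]

theorem norm_le_of_sobolevNorm_le {p E : ℝ} (hp : 0 < p) (hE : 0 ≤ E) {f : L2 n}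
    (hf : sobolevNorm p f ≤ ENNReal.ofReal E) : ‖f‖ ≤ E := by
  rw [← Lp.norm_fourier_eq, ← ENNReal.ofReal_le_ofReal_iff hE, ofReal_norm_eq_eLpNorm]
  refine (eLpNorm_mono fun ξ => ?_).trans hf
  have hw : 1 ≤ (1 + ‖ξ‖ ^ 2) ^ (p / 2) :=
    Real.one_le_rpow (by nlinarith [sq_nonneg ‖ξ‖]) (by positivity)
  rw [norm_mul, Complex.norm_real, Real.norm_of_nonneg (by positivity)]
  exact le_mul_of_one_le_left (norm_nonneg _) hw

/-- The error of a regularized inverse splits into the approximation error, controlled by the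
Sobolev norm, and the propagated data error. -/
theorem norm_sub_regularized_le {B : L2 n →L[ℂ] L2 n} {b m : Space n → ℂ}
    (hbm : AEStronglyMeasurable b volume) (hmm : AEStronglyMeasurable m volume)
    (hB : ∀ f : L2 n, (𝓕 (B f) : L2 n) =ᵐ[volume] fun ξ => b ξ * (𝓕 f : L2 n) ξ)
    (hD : ∀ᵐ ξ, 0 < ‖b ξ‖ ^ 2 + ‖m ξ‖ ^ 2)
    (hr : MemLp (fun ξ => (starRingEnd ℂ) (b ξ) / ((‖b ξ‖ ^ 2 + ‖m ξ‖ ^ 2 : ℝ) : ℂ)) ∞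
      (volume : Measure (Space n)))
    {p E c₁ c₂ : ℝ} (hE : 0 ≤ E) (hc₁ : 0 ≤ c₁) (hc₂ : 0 ≤ c₂)
    (h₁ : ∀ᵐ ξ, ‖m ξ‖ ^ 2 / (‖b ξ‖ ^ 2 + ‖m ξ‖ ^ 2) ≤ c₁ * (1 + ‖ξ‖ ^ 2) ^ (p / 2))
    (h₂ : ∀ᵐ ξ, ‖b ξ‖ / (‖b ξ‖ ^ 2 + ‖m ξ‖ ^ 2) ≤ c₂)
    {f : L2 n} (hf : sobolevNorm p f ≤ ENNReal.ofReal E) (g : L2 n) :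
    ‖f - fourierMultiplier _ hr g‖ ≤ c₁ * E + c₂ * ‖B f - g‖ := by
  set D : Space n → ℝ := fun ξ => ‖b ξ‖ ^ 2 + ‖m ξ‖ ^ 2 with hDdef
  have hDm : AEStronglyMeasurable D volume := (hbm.norm.pow 2).add (hmm.norm.pow 2)
  set F₁ : Space n → ℂ := fun ξ => ((‖m ξ‖ ^ 2 / D ξ : ℝ) : ℂ) * (𝓕 f : L2 n) ξ
  set F₂ : Space n → ℂ := fun ξ =>
    (starRingEnd ℂ) (b ξ) / (D ξ : ℂ) * (𝓕 (B f - g) : L2 n) ξ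
  have hF₁m : AEStronglyMeasurable F₁ volume :=
    (Complex.continuous_ofReal.comp_aestronglyMeasurable
      ((hmm.norm.pow 2).div₀ hDm)).mul (Lp.aestronglyMeasurable _)
  have hF₂m : AEStronglyMeasurable F₂ volume := hr.1.mul (Lp.aestronglyMeasurable _)
  -- With `r = conj b / D`, this is `f̂ - r ĝ = (1 - r b) f̂ + r (b f̂ - ĝ)` and `1 - r b = |m|² /
  -- D`.
  have hsplit : (𝓕 (f - fourierMultiplier _ hr g) : L2 n) =ᵐ[volume] F₁ + F₂ := by
    have hsub := Lp.coeFn_sub (𝓕 f : L2 n) (𝓕 (fourierMultiplier _ hr g))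
    have hsub' := Lp.coeFn_sub (𝓕 (B f) : L2 n) (𝓕 g)
    rw [← fourier_L2_sub] at hsub hsub'
    filter_upwards [hsub, hsub', hB f, fourier_fourierMultiplier _ hr g, hD] with ξ e1 e2 e3 e4 e5
    have hne : (D ξ : ℂ) ≠ 0 := Complex.ofReal_ne_zero.2 e5.ne'
    have hsum : (D ξ : ℂ) = (starRingEnd ℂ) (b ξ) * b ξ + ((‖m ξ‖ ^ 2 : ℝ) : ℂ) := by
      rw [Complex.conj_mul', hDdef]; push_cast; rfl
    simp only [Pi.add_apply, F₁, F₂]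
    rw [e1, e2, Pi.sub_apply, Pi.sub_apply, e3, e4, Complex.ofReal_div]
    change _ - (starRingEnd ℂ) (b ξ) / (D ξ : ℂ) * _ = _
    field_simp
    rw [hsum]
    ring
  have hF₁ : eLpNorm F₁ 2 volume ≤ ENNReal.ofReal (c₁ * E) := by
    rw [ENNReal.ofReal_mul hc₁]
    refine (eLpNorm_le_mul_eLpNorm_of_ae_le_mul ?_ 2).trans (mul_le_mul_right hf _)
    filter_upwards [h₁, hD] with ξ e1 e2
    rw [norm_mul, norm_mul, Complex.norm_real, Complex.norm_real,
      Real.norm_of_nonneg (div_nonneg (sq_nonneg _) e2.le), Real.norm_of_nonneg (by positivity),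
      ← mul_assoc]
    exact mul_le_mul_of_nonneg_right e1 (norm_nonneg _)
  have hF₂ : eLpNorm F₂ 2 volume ≤ ENNReal.ofReal (c₂ * ‖B f - g‖) := by
    rw [ENNReal.ofReal_mul hc₂, ← Lp.norm_fourier_eq (B f - g), ofReal_norm_eq_eLpNorm]
    refine eLpNorm_le_mul_eLpNorm_of_ae_le_mul ?_ 2
    filter_upwards [h₂, hD] with ξ e1 e2
    rw [norm_mul, norm_div, RCLike.norm_conj, Complex.norm_real, Real.norm_of_nonneg e2.le]
    exact mul_le_mul_of_nonneg_right e1 (norm_nonneg _)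
  rw [← Lp.norm_fourier_eq, ← ENNReal.ofReal_le_ofReal_iff (by positivity),
    ofReal_norm_eq_eLpNorm, eLpNorm_congr_ae hsplit,
    ENNReal.ofReal_add (by positivity) (by positivity)]
  exact (eLpNorm_add_le hF₁m hF₂m one_le_two).trans (add_le_add hF₁ hF₂)

/-! ### Assembling the convergence rate -/

theorem logSource_sq {q ε : ℝ} (hε : 0 < ε) (hε1 : ε < 1) :
    logSource q (ε ^ 2) = 2 ^ (-q) * (-Real.log ε) ^ (-q) := by
  rw [logSource, Real.log_pow,
    ← Real.mul_rpow zero_le_two (neg_nonneg.2 (Real.log_nonpos hε.le hε1.le))]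
  congr 1; push_cast; ring

/-- The difference of the operators has symbol `ψ - b`, which the operator norm dominates almost
everywhere. -/
theorem heatSymbol_sub_le_norm_symbol {τ T : ℝ} (hτ : 0 < τ) (hT : 0 < T) {γ : ℝ → ℝ}
    (hγ : ∀ t ∈ Ioo 0 T, 0 < γ t) {B : L2 n →L[ℂ] L2 n} {b : Space n → ℂ}
    (hbm : AEStronglyMeasurable b volume)
    (hB : ∀ f : L2 n, (𝓕 (B f) : L2 n) =ᵐ[volume] fun ξ => b ξ * (𝓕 f : L2 n) ξ)
    {h : ℝ} (hh : ‖heatOperator n τ T hτ hT γ hγ - B‖ ≤ h) :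
    ∀ᵐ ξ, heatSymbol τ T γ ξ - h ≤ ‖b ξ‖ := by
  have hψ := memLp_heatSymbol (n := n) τ T hτ hT γ hγ
  have hsym : ∀ f : L2 n, (𝓕 ((heatOperator n τ T hτ hT γ hγ - B) f) : L2 n) =ᵐ[volume]
      fun ξ => ((heatSymbol τ T γ ξ : ℂ) - b ξ) * (𝓕 f : L2 n) ξ := by
    intro f
    have hsub := Lp.coeFn_sub (𝓕 (heatOperator n τ T hτ hT γ hγ f) : L2 n) (𝓕 (B f))
    rw [← fourier_L2_sub] at hsub
    filter_upwards [hsub, hB f, fourier_fourierMultiplier _ hψ f] with ξ e1 e2 e3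
    rw [sub_apply, e1, Pi.sub_apply, e2, sub_mul, ← e3]
    rfl
  filter_upwards [norm_symbol_le_of_opNorm_le (hψ.1.sub hbm) hsym hh] with ξ e
  have h1 := norm_sub_norm_le (heatSymbol τ T γ ξ : ℂ) (b ξ)
  have h0 : 0 ≤ heatSymbol τ T γ ξ := (Real.exp_pos _).le
  rw [Complex.norm_real, Real.norm_of_nonneg h0] at h1
  have h2 : ‖(heatSymbol τ T γ ξ : ℂ) - b ξ‖ ≤ h := e
  linarith

/-- Existence, uniqueness and the error bound in terms of `L = -ln(h + δ/ρ)`. -/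
theorem exists_unique_reconstruction_and_bound {τ T : ℝ} (hτ : 0 < τ) (hT : 0 < T) {γ : ℝ → ℝ}
    (hγ : ∀ t ∈ Ioo 0 T, 0 < γ t) {φ : Space n → ℝ} (hφ : Integrable φ volume)
    (hφlt : ∀ ξ : Space n, ξ ≠ 0 → ‖𝓕 (fun x => (φ x : ℂ)) ξ‖ < 1) {s : ℝ} (hs : 0 < s)
    (hφs : (fun ξ : Space n => ‖1 - 𝓕 (fun x => (φ x : ℂ)) ξ‖) =Θ[𝓝 0] fun ξ => ‖ξ‖ ^ s)
    {p : ℝ} (hp : 0 < p) {η : ℝ} (hη : 0 < η) (hη1 : η < 1) :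
    ∃ K > 0, ∀ ε : ℝ, 0 < ε → ε ≤ η → ∀ Ah : L2 n →L[ℂ] L2 n, IsConvolutionOperator Ah →
      ‖heatOperator n τ T hτ hT γ hγ - Ah‖ ≤ ε → ∀ g : L2 n,
      ∃ v : L2 n, (∀ w, IsReconstruction φ (ε ^ (1 / (2 * s))) Ah g w ↔ w = v) ∧
        ∀ (E : ℝ) (f : L2 n), 0 ≤ E → sobolevNorm p f ≤ ENNReal.ofReal E →
          ‖f - v‖ ≤ K * (-Real.log ε) ^ (-(p / (2 * τ))) * E +
            K * ε ^ (-(1 / 2) : ℝ) * ‖Ah f - g‖ := by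
  obtain ⟨c, hc, C, hC, hbounds⟩ := exists_bounds_one_sub_fourier hφ hφlt hs hφs
  set Γ := ∫ t in (0 : ℝ)..T, γ t with hΓdef
  have hΓ : 0 ≤ Γ := by
    rw [hΓdef, intervalIntegral.integral_of_le hT.le, integral_Ioc_eq_integral_Ioo]
    exact setIntegral_nonneg measurableSet_Ioo fun t ht => (hγ t ht).le
  obtain ⟨K₁, hK₁, hinv⟩ := exists_bound_regularized_inverse (Γ := Γ) hτ hs hc hη1
  obtain ⟨K₂, hK₂, hfil⟩ := exists_bound_filter hτ hΓ hs hC hp hη hη1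
  refine ⟨K₁ + K₂, by positivity, fun ε hε hεη Ah hAh hA g => ?_⟩
  obtain ⟨b, hbm, hB⟩ := hAh
  have hlog : 0 < -Real.log ε := neg_pos.2 (Real.log_neg hε (hεη.trans_lt hη1))
  set L := -Real.log ε with hL
  have hεL : Real.exp (-L) = ε := by rw [hL, neg_neg, Real.exp_log hε]
  set β := ε ^ (1 / (2 * s)) with hβdef
  have hβ : 0 < β := Real.rpow_pos_of_pos hε _
  have hβs : β ^ s = Real.exp (-(1 / 2 * L)) := by
    rw [hβdef, ← hεL, ← Real.exp_mul, ← Real.exp_mul]; congr 1; field_simp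
  set m : Space n → ℂ := fun ξ => 1 - 𝓕 (fun x => (φ x : ℂ)) (β • ξ) with hm
  have hnorm : ∀ ξ : Space n, ‖β • ξ‖ ^ s = Real.exp (-(1 / 2 * L)) * ‖ξ‖ ^ s := fun ξ => by
    rw [norm_smul, Real.norm_of_nonneg hβ.le, Real.mul_rpow hβ.le (norm_nonneg _), hβs]
  have hmb : ∀ ξ, ‖m ξ‖ ≤ C * (Real.exp (-(1 / 2 * L)) * ‖ξ‖ ^ s) ∧
      c * min 1 (Real.exp (-(1 / 2 * L)) * ‖ξ‖ ^ s) ≤ ‖m ξ‖ := fun ξ => by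
    rw [← hnorm]; exact hbounds (β • ξ)
  have hlow : ∀ᵐ ξ, Real.exp (-((2 * Real.pi * ‖ξ‖) ^ (2 * τ) * Γ)) - Real.exp (-L) ≤ ‖b ξ‖ := by
    rw [hεL]; exact heatSymbol_sub_le_norm_symbol hτ hT hγ hbm hB hA
  have hpt : ∀ᵐ ξ, 0 < ‖b ξ‖ ^ 2 + ‖m ξ‖ ^ 2 ∧
      ‖b ξ‖ / (‖b ξ‖ ^ 2 + ‖m ξ‖ ^ 2) ≤ K₁ * Real.exp (1 / 2 * L) := by
    filter_upwards [hlow] with ξ hξ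
    exact hinv L hlog (hεL.trans_le hεη) _ (norm_nonneg ξ) _ _ hξ (norm_nonneg _) (norm_nonneg _)
      (hmb ξ).2
  have hD : ∀ᵐ ξ, 0 < ‖b ξ‖ ^ 2 + ‖m ξ‖ ^ 2 := hpt.mono fun ξ h => h.1
  have hmm : AEStronglyMeasurable m (volume : Measure (Space n)) := (memLp_one_sub_fourier hφ β).1
  have hr : MemLp (fun ξ => (starRingEnd ℂ) (b ξ) / ((‖b ξ‖ ^ 2 + ‖m ξ‖ ^ 2 : ℝ) : ℂ)) ∞
      (volume : Measure (Space n)) := by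
    refine memLp_top_of_bound ((Complex.continuous_conj.comp_aestronglyMeasurable hbm).div₀
      (Complex.continuous_ofReal.comp_aestronglyMeasurable
        ((hbm.norm.pow 2).add (hmm.norm.pow 2)))) (K₁ * Real.exp (1 / 2 * L)) ?_
    filter_upwards [hpt] with ξ hξ
    rw [norm_div, RCLike.norm_conj, Complex.norm_real, Real.norm_of_nonneg hξ.1.le]
    exact hξ.2
  refine ⟨fourierMultiplier _ hr g, isReconstruction_iff hφ hβ hm hB hD hr g, fun E f hE hf => ?_⟩
  have hLq : 0 < L ^ (-(p / (2 * τ))) := Real.rpow_pos_of_pos hlog _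
  have hexp : ε ^ (-(1 / 2) : ℝ) = Real.exp (1 / 2 * L) := by
    rw [← hεL, ← Real.exp_mul]; congr 1; ring
  have hmain := norm_sub_regularized_le (c₁ := K₂ * L ^ (-(p / (2 * τ))))
    (c₂ := K₁ * Real.exp (1 / 2 * L)) hbm hmm hB hD hr hE (by positivity) (by positivity)
    (by
      filter_upwards [hlow, hD] with ξ h1 h2
      exact hfil L hlog (hεL.trans_le hεη) _ (norm_nonneg ξ) _ _ h1 (norm_nonneg _) (hmb ξ).1 h2)
    (hpt.mono fun ξ h => h.2) hf g
  rw [hexp]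
  refine hmain.trans ?_
  gcongr
  · linarith
  · linarith

end BackwardHeat

end

theorem mainTheorem2 (n : ℕ)
    (τ T : ℝ) (hτ : 0 < τ) (hτ1 : τ ≤ 1) (hT : 0 < T)
    (γ : ℝ → ℝ) (hγ : ∀ t ∈ Ioo 0 T, 0 < γ t) (hγint : IntegrableOn γ (Ioo 0 T) volume)
    (φ : BackwardHeat.Space n → ℝ) (hφ : Integrable φ volume) (hφ1 : ∫ x, φ x = 1)
    (hφlt : ∀ ξ : BackwardHeat.Space n, ξ ≠ 0 → ‖𝓕 (fun x => (φ x : ℂ)) ξ‖ < 1)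
    (s : ℝ) (hs : 0 < s)
    (hφs : (fun ξ : BackwardHeat.Space n => ‖1 - 𝓕 (fun x => (φ x : ℂ)) ξ‖)
      =Θ[𝓝 0] fun ξ => ‖ξ‖ ^ s)
    (p : ℝ) (hp : 0 < p) (Cp : ℝ) (hCp : 0 < Cp) (η : ℝ) (hη : 0 < η) (hη1 : η < 1) :
    ∃ K : ℝ, 0 < K ∧
      ∀ E : ℝ, 0 < E → ∀ ρ : ℝ, ρ = Cp * E →
      ∀ u : ℝ → BackwardHeat.L2 n, BackwardHeat.IsHeatSolution τ T γ u →
      BackwardHeat.sobolevNorm p (u 0) ≤ ENNReal.ofReal E →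
      ∀ δ h : ℝ, 0 < h + δ / ρ → h + δ / ρ ≤ η →
      ∀ gδ : BackwardHeat.L2 n, ‖u T - gδ‖ ≤ δ →
      ∀ Ah : BackwardHeat.L2 n →L[ℂ] BackwardHeat.L2 n,
      BackwardHeat.IsConvolutionOperator Ah →
      ‖BackwardHeat.heatOperator n τ T hτ hT γ hγ - Ah‖ ≤ h → ‖Ah‖ ≤ 1 →
      (∃! v : BackwardHeat.L2 n,
        BackwardHeat.IsReconstruction φ ((h + δ / ρ) ^ (1 / (2 * s))) Ah gδ v) ∧
      ∀ v : BackwardHeat.L2 n,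
        BackwardHeat.IsReconstruction φ ((h + δ / ρ) ^ (1 / (2 * s))) Ah gδ v →
        ‖u 0 - v‖ ≤ K * ρ * BackwardHeat.logSource (p / (2 * τ)) ((h + δ / ρ) ^ 2) := by
  obtain ⟨K, hK, hmain⟩ := BackwardHeat.exists_unique_reconstruction_and_bound hτ hT hγ hφ hφlt hs
    hφs hp hη hη1
  set q := p / (2 * τ) with hq
  have hq0 : 0 < q := by positivity
  set A := (q / (1 / 2)) ^ q with hA
  have hA0 : 0 < A := by positivity
  -- `2 ^ q` undoes the square inside `logSource`, `1 / Cp` converts `E` to `ρ`, and the last term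
  -- pays for the data error.
  refine ⟨K * 2 ^ q * (1 / Cp + (1 + 1 / Cp) * A), by positivity, ?_⟩
  intro E hE ρ hρ u hu huE δ h hε hεη gδ hgδ Ah hAh hAAh _
  have hρ0 : 0 < ρ := by rw [hρ]; positivity
  have hδ0 : 0 ≤ δ := (norm_nonneg _).trans hgδ
  have hh0 : 0 ≤ h := (norm_nonneg _).trans hAAh
  have hδρ : 0 ≤ δ / ρ := by positivity
  set ε := h + δ / ρ with hεdef
  obtain ⟨v, hv, hbound⟩ := hmain ε hε hεη Ah hAh (hAAh.trans (by linarith)) gδ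
  refine ⟨⟨v, (hv v).2 rfl, fun w hw => (hv w).1 hw⟩, fun w hw => ?_⟩
  rw [(hv w).1 hw]
  have huT := BackwardHeat.heatOperator_apply_of_isHeatSolution hτ hT hγ hγint hu
  have hu0 := BackwardHeat.norm_le_of_sobolevNorm_le hp hE.le huE
  have hEρ : E = ρ / Cp := by rw [hρ]; field_simp
  have hdata : ‖Ah (u 0) - gδ‖ ≤ ρ * ((1 + 1 / Cp) * ε) := by
    have e : Ah (u 0) - gδ =
        (u T - gδ) - (BackwardHeat.heatOperator n τ T hτ hT γ hγ - Ah) (u 0) := by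
      rw [sub_apply, huT]; abel
    calc ‖Ah (u 0) - gδ‖ ≤ δ + h * E := by
          rw [e]
          refine (norm_sub_le _ _).trans (add_le_add hgδ ?_)
          exact (ContinuousLinearMap.le_opNorm _ _).trans
            (mul_le_mul hAAh hu0 (norm_nonneg _) hh0)
      _ = ρ * (δ / ρ + 1 / Cp * h) := by rw [hEρ]; field_simp
      _ ≤ ρ * ((1 + 1 / Cp) * ε) := by
          gcongr
          have h1 : 0 ≤ 1 / Cp * (δ / ρ) := by positivity
          rw [hεdef]
          linarith
  have hε1 : ε < 1 := hεη.trans_lt hη1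
  have hlog : 0 < -Real.log ε := neg_pos.2 (Real.log_neg hε hε1)
  set S := (-Real.log ε) ^ (-q) with hS
  -- Inverse norm `ε^{-1/2}` times residual `ε` is `exp (-L/2)`, hence `O(L^{-q})`.
  have hsqrt : ε ^ (-(1 / 2) : ℝ) * ε ≤ A * S := by
    have h1 := BackwardHeat.exp_neg_le_mul_rpow_neg hq0 (by norm_num : (0 : ℝ) < 1 / 2) hlog
    have h2 : ε ^ (-(1 / 2) : ℝ) * ε = Real.exp (-(1 / 2 * -Real.log ε)) := by
      nth_rw 2 [← Real.exp_log hε]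
      rw [Real.rpow_def_of_pos hε, ← Real.exp_add]
      congr 1; ring
    rw [h2]
    exact h1
  have hε2 : 0 < ε ^ (-(1 / 2) : ℝ) := Real.rpow_pos_of_pos hε _
  rw [BackwardHeat.logSource_sq hε hε1]
  calc ‖u 0 - v‖ ≤ K * S * E + K * ε ^ (-(1 / 2) : ℝ) * ‖Ah (u 0) - gδ‖ :=
        hbound E (u 0) hE.le huE
    _ ≤ K * S * (ρ / Cp) + K * ε ^ (-(1 / 2) : ℝ) * (ρ * ((1 + 1 / Cp) * ε)) := by
        rw [← hEρ]; gcongr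
    _ = K * S * (ρ / Cp) + K * ρ * (1 + 1 / Cp) * (ε ^ (-(1 / 2) : ℝ) * ε) := by ring
    _ ≤ K * S * (ρ / Cp) + K * ρ * (1 + 1 / Cp) * (A * S) := by gcongr
    _ = K * 2 ^ q * (1 / Cp + (1 + 1 / Cp) * A) * ρ * (2 ^ (-q) * S) := by
        rw [Real.rpow_neg zero_le_two]
        field_simp
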